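/- For a connected undirected graph $G$ on $n$ vertices (possibly with loops) with adjacency matrix $A$ and no zero row sum, let $D$ be the diagonal matrix of the row sums of $A$ (a loop contributes $1$) and $P=D^{-1}A$. Kemeny's constant of $G$ is $$\kappa(G)=\operatorname{trace}\bigl((I-P+\mathbf 1 v^{\top})^{-1}\bigr)-1,$$ where $v\in\mathbb R^n$ is any vector with $v^{\top}\mathbf 1=1$ (the inverse exists, and the value is the same for every such $v$). Let $p,q,r\ge 0$ be integers with $s=p+q+r\ge 1$. Let $E_{p,q,r}$ be the tree on the vertices $1,\dots,s+1$ formed by three paths (branches) with $p$, $q$ and $r$ edges that share only the root $1$: going outwards from the root, the further vertices of the branches are $2,\dots,p+1$; $\;p+2,\dots,p+q+1$; and $p+q+2,\dots,p+q+r+1$. Let $E_{p,q,r,p+1}$ be the graph obtained from $E_{p,q,r}$ by adding a loop at the vertex $p+1$, the end of the first branch (the root if $p=0$). Then $$\kappa(E_{p,q,r})=\frac{2s^2+1}{6}-\frac{2pqr}{s},\qquad \kappa(E_{p,q,r,p+1})=\frac{s(s+1)}{3}-2qr\,\frac{2p+1}{2s+1}.$$ -/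

import Mathlib

/-- The tree `E_{p,q,r}`: three branches with `p`, `q` and `r` edges glued at a root.
The vertex with the label `k` (`1 ≤ k ≤ p + q + r + 1`) is the element `k - 1` of
`Fin (p + q + r + 1)`: the root is `0`, and the branches are the consecutive blocks
`1, …, p`, then `p + 1, …, p + q`, then `p + q + 1, …, p + q + r`, each listed from the root
outwards. So `i` is joined to `i + 1` unless `i + 1` is the first vertex of the second or of the
third block, and these first vertices are joined to the root. -/
def threeBranchTree (p q r : ℕ) : SimpleGraph (Fin (p + q + r + 1)) :=
  SimpleGraph.fromRel fun i j =>
    ((j : ℕ) = i + 1 ∧ (j : ℕ) ≠ p + 1 ∧ (j : ℕ) ≠ p + q + 1) ∨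
      ((i : ℕ) = 0 ∧ ((j : ℕ) = p + 1 ∨ (j : ℕ) = p + q + 1))

open Classical in
/-- The adjacency matrix of `E_{p,q,r}`. -/
noncomputable def threeBranchAdj (p q r : ℕ) :
    Matrix (Fin (p + q + r + 1)) (Fin (p + q + r + 1)) ℝ :=
  (threeBranchTree p q r).adjMatrix ℝ

/-- The adjacency matrix of `E_{p,q,r,k}`, i.e. of `E_{p,q,r}` with a loop (of weight one) added
at the vertex `k`. -/
noncomputable def threeBranchLoopAdj (p q r : ℕ) (k : Fin (p + q + r + 1)) :
    Matrix (Fin (p + q + r + 1)) (Fin (p + q + r + 1)) ℝ :=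
  threeBranchAdj p q r + Matrix.single k k 1

/-- The stochastic matrix `P = D⁻¹ A` of the random walk on the (weighted) graph with adjacency
matrix `A`, where `D` is the diagonal matrix of the row sums of `A`. -/
noncomputable def transitionMatrix {n : Type*} [Fintype n] [DecidableEq n] (A : Matrix n n ℝ) :
    Matrix n n ℝ :=
  Matrix.diagonal (fun i => (∑ j, A i j)⁻¹) * A

/-- The graph with adjacency matrix `A` has Kemeny's constant `κ`: for `P = D⁻¹ A` and every vector
`v` with `vᵀ 1 = 1`, the matrix `I - P + 1 vᵀ` is invertible and
`κ = trace ((I - P + 1 vᵀ)⁻¹) - 1`. -/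
def HasKemenyConstant {n : Type*} [Fintype n] [DecidableEq n] (A : Matrix n n ℝ) (κ : ℝ) : Prop :=
  ∀ v : n → ℝ, ∑ i, v i = 1 →
    IsUnit (1 - transitionMatrix A + Matrix.vecMulVec (fun _ => 1) v) ∧
      κ = ((1 - transitionMatrix A + Matrix.vecMulVec (fun _ => 1) v)⁻¹).trace - 1

/-!
Let `d` be the row sums of `A`, with total `σ`, and let `G` be any matrix with
`(diag d - A) G = 1 - x 1ᵀ` for some `x`. Centering `G` produces a matrix `Z` with
`(1 - P) Z = 1 - 1 πᵀ` and `Z 1 = 0`, so that `κ = trace Z = ∑ i, d i * G i i - dᵀ G d / σ`.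

Loops do not change the Laplacian `diag d - A`. For a tree with root `⊥`, let `ζ` be the zeta matrix
of the tree order and `N` the matrix of its covering relation. Then `ζ (1 - N) = 1` and the
Laplacian is `(1 - N) (1 - N)ᵀ` up to a rank one term at the root, so `G = ζᵀ ζ` is admissible.
With `w = ζ d`, the total row sum above each vertex, this gives `κ = ∑ e, w e * (σ - w e) / σ`,
where a vertex other than the root stands for the edge to its parent and the root contributes `0`.

In `E_{p,q,r}` the edge with `k` further edges above it has `w = 2 k + 1`, or `w = 2 k + 1 + t` if a
loop of weight `t` lies above it.
-/

open Matrix SimpleGraph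

section Laplacian

variable {n R : Type*} [Fintype n] [DecidableEq n]

theorem diagonal_mulVec_one [NonAssocSemiring R] (d : n → R) : diagonal d *ᵥ 1 = d := by
  ext i
  simp [mulVec_diagonal]

theorem diagonal_inv_mul_diagonal [DivisionRing R] {d : n → R} (hd : ∀ i, d i ≠ 0) :
    diagonal d⁻¹ * diagonal d = 1 := by
  rw [diagonal_mul_diagonal, ← diagonal_one]
  congr 1
  ext i
  exact inv_mul_cancel₀ (hd i)

/-- The Laplacian `D - A` of the weighted graph with adjacency matrix `A`, where `D` is the diagonal
matrix of the row sums of `A`. -/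
def weightedLaplacian [NonAssocRing R] (A : Matrix n n R) : Matrix n n R :=
  diagonal (A *ᵥ 1) - A

theorem weightedLaplacian_mulVec_one [NonAssocRing R] (A : Matrix n n R) :
    weightedLaplacian A *ᵥ 1 = 0 := by
  rw [weightedLaplacian, sub_mulVec, diagonal_mulVec_one, sub_self]

theorem weightedLaplacian_add_diagonal [NonAssocRing R] (A : Matrix n n R) (c : n → R) :
    weightedLaplacian (A + diagonal c) = weightedLaplacian A := by
  have hdiag : diagonal (A *ᵥ 1 + c) = diagonal (A *ᵥ 1) + diagonal c := (diagonal_add _ _).symm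
  rw [weightedLaplacian, weightedLaplacian, add_mulVec, diagonal_mulVec_one, hdiag,
    add_sub_add_right_eq_sub]

theorem one_sub_transitionMatrix {A : Matrix n n ℝ} (hA : ∀ i, (A *ᵥ 1) i ≠ 0) :
    1 - transitionMatrix A = diagonal (A *ᵥ 1)⁻¹ * weightedLaplacian A := by
  rw [weightedLaplacian, mul_sub, diagonal_inv_mul_diagonal hA]
  simp [transitionMatrix, mulVec, dotProduct, Pi.inv_def]

end Laplacian

section CenteredGreen

variable {n K : Type*} [Fintype n] [Field K] {d : n → K}

theorem sum_inv_sum_smul (hd : ∑ i, d i ≠ 0) : ∑ j, ((∑ i, d i)⁻¹ • d) j = 1 := by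
  simp only [Pi.smul_apply, smul_eq_mul, ← Finset.mul_sum, inv_mul_cancel₀ hd]

variable [DecidableEq n]

/-- The matrix `(G - G d 1ᵀ / σ) D`, where `D = diag d` and `σ = ∑ i, d i`. If `G` is a Green matrix
of a Laplacian with row sums `d`, this is a Green matrix of the random walk whose rows sum to `0`,
like those of the group inverse of `1 - P`. -/
def centeredGreen (G : Matrix n n K) (d : n → K) : Matrix n n K :=
  G * diagonal d - vecMulVec (G *ᵥ d) ((∑ i, d i)⁻¹ • d)

theorem centeredGreen_mulVec_one (hd : ∑ i, d i ≠ 0) (G : Matrix n n K) :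
    centeredGreen G d *ᵥ 1 = 0 := by
  rw [centeredGreen, sub_mulVec, ← mulVec_mulVec, diagonal_mulVec_one, vecMulVec_mulVec,
    dotProduct_one, sum_inv_sum_smul hd, MulOpposite.op_one, one_smul, sub_self]

theorem mul_centeredGreen (hd : ∑ i, d i ≠ 0) {L G : Matrix n n K} {x : n → K}
    (hLG : L * G = 1 - vecMulVec x 1) :
    L * centeredGreen G d = diagonal d - vecMulVec d ((∑ i, d i)⁻¹ • d) := by
  have hLGd : L *ᵥ (G *ᵥ d) = d - (∑ i, d i) • x := by
    rw [mulVec_mulVec, hLG, sub_mulVec, one_mulVec, vecMulVec_mulVec, one_dotProduct,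
      op_smul_eq_smul]
  have hx : vecMulVec x 1 * diagonal d = vecMulVec ((∑ i, d i) • x) ((∑ i, d i)⁻¹ • d) := by
    rw [vecMulVec_mul, smul_vecMulVec, vecMulVec_smul, smul_inv_smul₀ hd]
    congr 1
    ext i
    simp [vecMul_diagonal]
  rw [centeredGreen, mul_sub, ← Matrix.mul_assoc, hLG, mul_vecMulVec, hLGd, sub_mul, one_mul, hx,
    sub_vecMulVec]
  abel

theorem trace_centeredGreen (G : Matrix n n K) (d : n → K) :
    (centeredGreen G d).trace = d ⬝ᵥ G.diag - d ⬝ᵥ G *ᵥ d / ∑ i, d i := by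
  rw [centeredGreen, trace_sub, trace_vecMulVec, dotProduct_smul, dotProduct_comm (G *ᵥ d),
    smul_eq_mul, inv_mul_eq_div]
  congr 1
  simp [Matrix.trace, dotProduct, mul_comm]

end CenteredGreen

section Kemeny

variable {n R : Type*} [Fintype n] [DecidableEq n]

theorem add_vecMulVec_one_mul_eq_one [CommRing R] {M Z : Matrix n n R} {π v : n → R}
    (hM : M *ᵥ 1 = 0) (hMZ : M * Z = 1 - vecMulVec 1 π) (hv : ∑ i, v i = 1) :
    (M + vecMulVec 1 v) * (Z + vecMulVec 1 (π - v ᵥ* Z)) = 1 := by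
  have hM_rank_one : M * vecMulVec 1 (π - v ᵥ* Z) = 0 := by
    rw [mul_vecMulVec, hM, zero_vecMulVec]
  have hv_rank_one : vecMulVec (1 : n → R) v * vecMulVec 1 (π - v ᵥ* Z) =
        vecMulVec 1 (π - v ᵥ* Z) := by
    rw [vecMulVec_mul_vecMulVec, dotProduct_one, hv, one_smul]
  rw [add_mul, mul_add, mul_add, hMZ, hM_rank_one, hv_rank_one, vecMulVec_mul, vecMulVec_sub]
  abel

theorem hasKemenyConstant_trace {A Z : Matrix n n ℝ} {π : n → ℝ}
    (hA : (1 - transitionMatrix A) *ᵥ 1 = 0)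
    (hAZ : (1 - transitionMatrix A) * Z = 1 - vecMulVec 1 π)
    (hZ : Z *ᵥ 1 = 0) (hπ : ∑ i, π i = 1) :
    HasKemenyConstant A Z.trace := by
  intro v hv
  have hinv := add_vecMulVec_one_mul_eq_one hA hAZ hv
  refine ⟨.of_mul_eq_one _ hinv, ?_⟩
  have htrace : (vecMulVec 1 (π - v ᵥ* Z)).trace = 1 := by
    rw [trace_vecMulVec, dotProduct_sub, one_dotProduct, hπ, dotProduct_comm,
      ← dotProduct_mulVec, hZ, dotProduct_zero, sub_zero]
  rw [show (fun _ ↦ 1 : n → ℝ) = 1 from rfl, inv_eq_right_inv hinv, trace_add, htrace,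
    add_sub_cancel_right]

theorem hasKemenyConstant_of_weightedLaplacian_mul {A G : Matrix n n ℝ} {x : n → ℝ}
    (hA : ∀ i, (A *ᵥ 1) i ≠ 0) (hσ : ∑ i, (A *ᵥ 1) i ≠ 0)
    (hG : weightedLaplacian A * G = 1 - vecMulVec x 1) :
    HasKemenyConstant A
      ((A *ᵥ 1) ⬝ᵥ G.diag - (A *ᵥ 1) ⬝ᵥ G *ᵥ (A *ᵥ 1) / ∑ i, (A *ᵥ 1) i) := by
  rw [← trace_centeredGreen]
  refine hasKemenyConstant_trace (π := (∑ i, (A *ᵥ 1) i)⁻¹ • (A *ᵥ 1)) ?_ ?_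
    (centeredGreen_mulVec_one hσ G) (sum_inv_sum_smul hσ)
  · rw [one_sub_transitionMatrix hA, ← mulVec_mulVec, weightedLaplacian_mulVec_one, mulVec_zero]
  · have hstationary : diagonal (A *ᵥ 1)⁻¹ *ᵥ (A *ᵥ 1) = 1 := by
      have hmul := congrArg (· *ᵥ 1) (diagonal_inv_mul_diagonal hA)
      rwa [← mulVec_mulVec, diagonal_mulVec_one, one_mulVec] at hmul
    rw [one_sub_transitionMatrix hA, Matrix.mul_assoc, mul_centeredGreen hσ hG, mul_sub,
      mul_vecMulVec, diagonal_inv_mul_diagonal hA, hstationary]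

theorem transitionMatrix_submatrix {m : Type*} [Fintype m] [DecidableEq m] (A : Matrix m m ℝ)
    (e : n ≃ m) :
    transitionMatrix (A.submatrix e e) = (transitionMatrix A).submatrix e e := by
  ext i j
  simp [transitionMatrix, e.sum_comp (A (e i))]

theorem HasKemenyConstant.submatrix_equiv {m : Type*} [Fintype m] [DecidableEq m]
    {A : Matrix m m ℝ} {κ : ℝ} (h : HasKemenyConstant A κ) (e : n ≃ m) :
    HasKemenyConstant (A.submatrix e e) κ := by
  intro v hv
  have hreindex : 1 - transitionMatrix (A.submatrix e e) + vecMulVec (fun _ ↦ 1) v =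
      (1 - transitionMatrix A + vecMulVec (fun _ ↦ 1) (v ∘ e.symm)).submatrix e e := by
    ext i j
    simp [transitionMatrix_submatrix, one_apply, vecMulVec_apply]
  have htrace (M : Matrix m m ℝ) : (M.submatrix e e).trace = M.trace :=
    e.sum_comp fun i ↦ M i i
  rw [hreindex, isUnit_submatrix_equiv, inv_submatrix_equiv, htrace]
  exact h (v ∘ e.symm) ((e.symm.sum_comp v).trans hv)

end Kemeny

section OrderTree

variable (R α : Type*) [PartialOrder α]

open scoped Classical in
/-- The zeta matrix of a partial order, with entry `1` at `(i, j)` if `i ≤ j` and `0` otherwise. -/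
noncomputable def zetaMatrix [Zero R] [One R] : Matrix α α R :=
  .of fun i j ↦ if i ≤ j then 1 else 0

open scoped Classical in
/-- The covering matrix of a partial order, with entry `1` at `(i, j)` if `j` covers `i` and `0`
otherwise. If the order is a rooted tree, this says that `i` is the parent of `j`. -/
noncomputable def covByMatrix [Zero R] [One R] : Matrix α α R :=
  .of fun i j ↦ if i ⋖ j then 1 else 0

variable {R α}

theorem covBy_iff_ne_bot_and_pred_eq [OrderBot α] [PredOrder α] {a b : α} :
    a ⋖ b ↔ b ≠ ⊥ ∧ Order.pred b = a := by
  refine ⟨fun h ↦ ⟨h.lt.ne_bot, h.pred_eq⟩, ?_⟩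
  rintro ⟨hb, rfl⟩
  exact Order.pred_covBy_of_not_isMin (by rwa [isMin_iff_eq_bot])

theorem adjMatrix_hasse [NonAssocSemiring R] [DecidableRel (hasse α).Adj] :
    (hasse α).adjMatrix R = covByMatrix R α + (covByMatrix R α)ᵀ := by
  classical
  ext i j
  simp only [adjMatrix_apply, hasse_adj, covByMatrix, Matrix.add_apply, transpose_apply, of_apply]
  by_cases hij : i ⋖ j
  · have hji : ¬j ⋖ i := fun h ↦ hij.lt.not_gt h.lt
    simp [hij, hji]
  · simp [hij]

section Zeta

variable [Fintype α] [OrderBot α] [NonAssocSemiring R]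

theorem zetaMatrix_mulVec_bot (x : α → R) : (zetaMatrix R α *ᵥ x) ⊥ = ∑ i, x i := by
  simp [zetaMatrix, mulVec, dotProduct]

variable [DecidableEq α]

theorem zetaMatrix_mulVec_single_bot : zetaMatrix R α *ᵥ Pi.single ⊥ 1 = Pi.single ⊥ 1 := by
  ext i
  simp [zetaMatrix, Pi.single_apply]

theorem single_bot_vecMul_zetaMatrix : Pi.single ⊥ 1 ᵥ* zetaMatrix R α = 1 := by
  ext i
  simp [zetaMatrix]

end Zeta

variable [OrderBot α] [PredOrder α] [DecidableEq α]

theorem covByMatrix_apply [Zero R] [One R] (i j : α) :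
    covByMatrix R α i j = if j ≠ ⊥ ∧ Order.pred j = i then 1 else 0 := by
  simp only [covByMatrix, of_apply, covBy_iff_ne_bot_and_pred_eq]

variable [Fintype α]

theorem zetaMatrix_mul_covByMatrix [NonAssocRing R] :
    zetaMatrix R α * covByMatrix R α = zetaMatrix R α - 1 := by
  classical
  ext i j
  simp only [mul_apply, covByMatrix_apply, zetaMatrix, of_apply, Matrix.sub_apply, one_apply]
  by_cases hj : j = ⊥
  · simp [hj]
  · have hle : i ≤ Order.pred j ↔ i < j :=
      Order.le_pred_iff_of_not_isMin (by rwa [isMin_iff_eq_bot])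
    rcases eq_or_ne i j with rfl | hij
    · simp [hj, hle]
    · simp [hj, hle, hij, lt_iff_le_and_ne]

theorem zetaMatrix_mul_one_sub_covByMatrix [NonAssocRing R] :
    zetaMatrix R α * (1 - covByMatrix R α) = 1 := by
  rw [mul_sub, zetaMatrix_mul_covByMatrix, mul_one, sub_sub_cancel]

theorem transpose_covByMatrix_mulVec_one [NonAssocRing R] :
    (covByMatrix R α)ᵀ *ᵥ 1 = 1 - Pi.single ⊥ 1 := by
  ext j
  by_cases hj : j = ⊥ <;> simp [mulVec, dotProduct, covByMatrix_apply, hj]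

theorem covByMatrix_mul_transpose [NonAssocSemiring R] :
    covByMatrix R α * (covByMatrix R α)ᵀ = diagonal (covByMatrix R α *ᵥ 1) := by
  ext i j
  simp only [mul_apply, transpose_apply, covByMatrix_apply, diagonal_apply, mulVec, dotProduct,
    Pi.one_apply, ite_mul, one_mul, zero_mul, ← ite_and]
  split_ifs with hij
  · simp [hij]
  · refine Finset.sum_eq_zero fun k _ ↦ if_neg ?_
    rintro ⟨⟨-, hi⟩, -, hj⟩
    exact hij (hi.symm.trans hj)

-- `1 - N` is the incidence matrix, each vertex `j ≠ ⊥` standing for the edge to its parent; the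
-- subtracted term discards the column of `⊥`.
theorem weightedLaplacian_adjMatrix_hasse [CommRing R] [DecidableRel (hasse α).Adj] :
    weightedLaplacian ((hasse α).adjMatrix R) =
      (1 - covByMatrix R α) * (1 - covByMatrix R α)ᵀ -
        vecMulVec (Pi.single ⊥ 1) (Pi.single ⊥ 1) := by
  have hdegree : diagonal (((hasse α).adjMatrix R) *ᵥ 1) =
      covByMatrix R α * (covByMatrix R α)ᵀ +
        (1 - vecMulVec (Pi.single ⊥ 1) (Pi.single ⊥ 1)) := by
    rw [covByMatrix_mul_transpose, ← single_eq_single_vecMulVec_single, ← diagonal_one,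
      ← diagonal_single, diagonal_sub, diagonal_add, adjMatrix_hasse, add_mulVec,
      transpose_covByMatrix_mulVec_one]
    rfl
  rw [weightedLaplacian, hdegree, adjMatrix_hasse, transpose_sub, transpose_one]
  noncomm_ring

theorem weightedLaplacian_adjMatrix_hasse_mul [CommRing R] [DecidableRel (hasse α).Adj] :
    weightedLaplacian ((hasse α).adjMatrix R) * ((zetaMatrix R α)ᵀ * zetaMatrix R α) =
      1 - vecMulVec (Pi.single ⊥ 1) 1 := by
  have hmoebius : (1 - covByMatrix R α) * zetaMatrix R α = 1 :=
    mul_eq_one_comm.mp zetaMatrix_mul_one_sub_covByMatrix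
  have hmoebius_transpose : (1 - covByMatrix R α)ᵀ * (zetaMatrix R α)ᵀ = 1 := by
    rw [← transpose_mul, zetaMatrix_mul_one_sub_covByMatrix, transpose_one]
  rw [weightedLaplacian_adjMatrix_hasse, ← Matrix.mul_assoc, sub_mul, Matrix.mul_assoc,
    hmoebius_transpose, vecMulVec_mul, vecMul_transpose, zetaMatrix_mulVec_single_bot, mul_one,
    sub_mul, hmoebius, vecMulVec_mul, single_bot_vecMul_zetaMatrix]

theorem zetaMatrix_mulVec_adjMatrix_hasse_add_diagonal [CommRing R] [DecidableRel (hasse α).Adj]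
    (c : α → R) :
    zetaMatrix R α *ᵥ (((hasse α).adjMatrix R + diagonal c) *ᵥ 1) =
      2 • (zetaMatrix R α *ᵥ 1) - 1 - Pi.single ⊥ 1 + zetaMatrix R α *ᵥ c := by
  simp only [add_mulVec, mulVec_add, adjMatrix_hasse, transpose_covByMatrix_mulVec_one,
    diagonal_mulVec_one, mulVec_sub, zetaMatrix_mulVec_single_bot]
  rw [mulVec_mulVec, zetaMatrix_mul_covByMatrix, sub_mulVec, one_mulVec]
  abel

section Real

variable [DecidableRel (hasse α).Adj] {c : α → ℝ}

theorem adjMatrix_hasse_add_diagonal_mulVec_one_pos [Nontrivial α] (hc : 0 ≤ c) (i : α) :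
    0 < (((hasse α).adjMatrix ℝ + diagonal c) *ᵥ 1) i := by
  obtain ⟨j, hj⟩ : ∃ j, (hasse α).Adj i j := by
    by_cases hi : i = ⊥
    · obtain ⟨a, ha⟩ := IsAtomic.exists_atom α
      exact ⟨a, hi ▸ .inl ha.bot_covBy⟩
    · exact ⟨Order.pred i, .inr (Order.pred_covBy_of_not_isMin (by rwa [isMin_iff_eq_bot]))⟩
  have hdegree : 0 < (hasse α).degree i := (degree_pos_iff_exists_adj _ i).mpr ⟨j, hj⟩
  rw [add_mulVec, diagonal_mulVec_one, Pi.add_apply, ← Function.const_one,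
    adjMatrix_mulVec_const_apply, mul_one]
  exact add_pos_of_pos_of_nonneg (mod_cast hdegree) (hc i)

theorem hasKemenyConstant_adjMatrix_hasse_add_diagonal [Nontrivial α] (hc : 0 ≤ c) {w : α → ℝ}
    (hw : w = zetaMatrix ℝ α *ᵥ (((hasse α).adjMatrix ℝ + diagonal c) *ᵥ 1)) :
    HasKemenyConstant ((hasse α).adjMatrix ℝ + diagonal c) ((∑ e, w e * (w ⊥ - w e)) / w ⊥) := by
  set A := (hasse α).adjMatrix ℝ + diagonal c with hA
  have hd : ∀ i, 0 < (A *ᵥ 1) i := adjMatrix_hasse_add_diagonal_mulVec_one_pos hc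
  have hbot : w ⊥ = ∑ i, (A *ᵥ 1) i := by rw [hw, zetaMatrix_mulVec_bot]
  have hσ : 0 < ∑ i, (A *ᵥ 1) i := Finset.sum_pos (fun i _ ↦ hd i) Finset.univ_nonempty
  have hG : weightedLaplacian A * ((zetaMatrix ℝ α)ᵀ * zetaMatrix ℝ α) =
      1 - vecMulVec (Pi.single ⊥ 1) 1 := by
    rw [hA, weightedLaplacian_add_diagonal, weightedLaplacian_adjMatrix_hasse_mul]
  have hdiag : (A *ᵥ 1) ⬝ᵥ ((zetaMatrix ℝ α)ᵀ * zetaMatrix ℝ α).diag = ∑ e, w e := by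
    have hidem (e i : α) : zetaMatrix ℝ α e i * zetaMatrix ℝ α e i = zetaMatrix ℝ α e i := by
      simp [zetaMatrix]
    calc (A *ᵥ 1) ⬝ᵥ ((zetaMatrix ℝ α)ᵀ * zetaMatrix ℝ α).diag
        = ∑ i, ∑ e, (A *ᵥ 1) i * zetaMatrix ℝ α e i := by
          simp only [dotProduct, diag_apply, mul_apply, transpose_apply, hidem, Finset.mul_sum]
      _ = ∑ e, w e := by
          rw [Finset.sum_comm, hw]
          exact Finset.sum_congr rfl fun e _ ↦ dotProduct_comm _ _
  have hquad : (A *ᵥ 1) ⬝ᵥ ((zetaMatrix ℝ α)ᵀ * zetaMatrix ℝ α) *ᵥ (A *ᵥ 1) = ∑ e, w e * w e := by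
    rw [← mulVec_mulVec, dotProduct_mulVec, vecMul_transpose, ← hw, dotProduct]
  convert hasKemenyConstant_of_weightedLaplacian_mul (fun i ↦ (hd i).ne') hσ.ne' hG using 1
  rw [hdiag, hquad, ← hbot, eq_sub_iff_add_eq, ← add_div, ← Finset.sum_add_distrib]
  simp only [mul_sub, sub_add_cancel, ← Finset.sum_mul]
  exact mul_div_cancel_right₀ _ (hbot ▸ hσ.ne')

end Real

end OrderTree

theorem sum_range_two_mul_add_mul_sub {K : Type*} [Field K] [CharZero K] (σ a : K) (l : ℕ) :
    ∑ k ∈ Finset.range l, (2 * (k : K) + a) * (σ - (2 * k + a)) =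
      l * (σ * (l - 1 + a) - (2 * (l - 1) * (2 * l - 1) / 3 + 2 * a * (l - 1) + a ^ 2)) := by
  induction l with
  | zero => simp
  | succ l ih =>
    rw [Finset.sum_range_succ, ih]
    push_cast
    ring

section ThreeBranch

variable {p q r : ℕ}

/-- The vertices of `E_{p,q,r}`, with the numbering of `threeBranchTree`. This copy of
`Fin (p + q + r + 1)` carries the tree order, where `i ≤ j` if `i` lies on the path from the root
to `j`. -/
@[ext]
structure ThreeBranchVertex (p q r : ℕ) where
  val : ℕ
  isLt : val < p + q + r + 1

/-- The number of the last vertex of the branch of `E_{p,q,r}` containing the vertex number `i`;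
the root is attributed to the first branch. -/
def branchEnd (p q r i : ℕ) : ℕ :=
  if i ≤ p then p else if i ≤ p + q then p + q else p + q + r

namespace ThreeBranchVertex

/-- The identity on vertex numbers. -/
@[simps]
def equivFin : ThreeBranchVertex p q r ≃ Fin (p + q + r + 1) where
  toFun i := ⟨i.val, i.isLt⟩
  invFun i := ⟨i, i.isLt⟩

instance : Fintype (ThreeBranchVertex p q r) := .ofEquiv _ equivFin.symm

instance : DecidableEq (ThreeBranchVertex p q r) := equivFin.decidableEq

instance : PartialOrder (ThreeBranchVertex p q r) where
  le i j := i.val = 0 ∨ i.val ≤ j.val ∧ branchEnd p q r i.val = branchEnd p q r j.val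
  le_refl i := .inr ⟨le_rfl, rfl⟩
  le_trans i j k hij hjk := by omega
  le_antisymm i j hij hji := by ext; omega

theorem le_def {i j : ThreeBranchVertex p q r} :
    i ≤ j ↔ i.val = 0 ∨ i.val ≤ j.val ∧ branchEnd p q r i.val = branchEnd p q r j.val :=
  Iff.rfl

instance : OrderBot (ThreeBranchVertex p q r) where
  bot := ⟨0, by omega⟩
  bot_le _ := .inl rfl

theorem eq_bot_iff_val {i : ThreeBranchVertex p q r} : i = ⊥ ↔ i.val = 0 :=
  ThreeBranchVertex.ext_iff

/-- The neighbour of `i` on the path to the root; the root is its own parent. -/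
def parent (i : ThreeBranchVertex p q r) : ThreeBranchVertex p q r where
  val := if i.val = p + 1 ∨ i.val = p + q + 1 then 0 else i.val - 1
  isLt := by have := i.isLt; split_ifs <;> omega

theorem parent_le (i : ThreeBranchVertex p q r) : i.parent ≤ i := by
  simp only [le_def, parent, branchEnd]
  split_ifs <;> omega

theorem isMin_of_le_parent {i : ThreeBranchVertex p q r} (h : i ≤ i.parent) : IsMin i := by
  rw [isMin_iff_eq_bot, eq_bot_iff_val]
  simp only [le_def, parent] at h
  split_ifs at h <;> omega

theorem le_parent_of_lt {i j : ThreeBranchVertex p q r} (h : i < j) : i ≤ j.parent := by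
  have hne : i.val ≠ j.val := fun hval ↦ h.ne (ThreeBranchVertex.ext hval)
  have hle := le_def.mp h.le
  have hj := j.isLt
  simp only [le_def, parent, branchEnd] at hle ⊢
  split_ifs at hle ⊢ <;> omega

instance : PredOrder (ThreeBranchVertex p q r) where
  pred := parent
  pred_le := parent_le
  min_of_le_pred := isMin_of_le_parent
  le_pred_of_lt := le_parent_of_lt

theorem covBy_iff {i j : ThreeBranchVertex p q r} :
    i ⋖ j ↔ j.val ≠ 0 ∧
      i.val = if j.val = p + 1 ∨ j.val = p + q + 1 then 0 else j.val - 1 := by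
  rw [covBy_iff_ne_bot_and_pred_eq, Ne, eq_bot_iff_val, eq_comm (b := i), ThreeBranchVertex.ext_iff]
  rfl

theorem branchEnd_lt (i : ThreeBranchVertex p q r) : branchEnd p q r i.val < p + q + r + 1 := by
  unfold branchEnd
  split_ifs <;> omega

theorem le_branchEnd (i : ThreeBranchVertex p q r) : i.val ≤ branchEnd p q r i.val := by
  have := i.isLt
  unfold branchEnd
  split_ifs <;> omega

theorem le_iff_le_branchEnd {i j : ThreeBranchVertex p q r} (hi : i ≠ ⊥) :
    i ≤ j ↔ i.val ≤ j.val ∧ j.val ≤ branchEnd p q r i.val := by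
  have hi_val : i.val ≠ 0 := mt eq_bot_iff_val.mpr hi
  have := j.isLt
  simp only [le_def, branchEnd]
  split_ifs <;> omega

theorem zetaMatrix_mulVec_one_apply {i : ThreeBranchVertex p q r} (hi : i ≠ ⊥) :
    (zetaMatrix ℝ (ThreeBranchVertex p q r) *ᵥ 1) i =
      ((branchEnd p q r i.val - i.val : ℕ) : ℝ) + 1 := by
  have hcard : ((Finset.range (p + q + r + 1)).filter
      fun j ↦ i.val ≤ j ∧ j ≤ branchEnd p q r i.val).card = branchEnd p q r i.val - i.val + 1 := by
    rw [← Nat.sub_add_comm (le_branchEnd i), ← Nat.card_Icc]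
    congr 1
    have := branchEnd_lt i
    ext j
    simp only [Finset.mem_filter, Finset.mem_range, Finset.mem_Icc]
    omega
  calc (zetaMatrix ℝ (ThreeBranchVertex p q r) *ᵥ 1) i
      = ∑ j : ThreeBranchVertex p q r,
          if i.val ≤ j.val ∧ j.val ≤ branchEnd p q r i.val then (1 : ℝ) else 0 := by
        classical
        simp [zetaMatrix, mulVec, dotProduct, le_iff_le_branchEnd hi]
    _ = ∑ j ∈ Finset.range (p + q + r + 1),
          if i.val ≤ j ∧ j ≤ branchEnd p q r i.val then (1 : ℝ) else 0 := by
        rw [← Fin.sum_univ_eq_sum_range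
          (fun j ↦ if i.val ≤ j ∧ j ≤ branchEnd p q r i.val then (1 : ℝ) else 0)]
        exact equivFin.sum_comp fun j ↦
          if i.val ≤ (j : ℕ) ∧ (j : ℕ) ≤ branchEnd p q r i.val then (1 : ℝ) else 0
    _ = ((branchEnd p q r i.val - i.val : ℕ) : ℝ) + 1 := by
        rw [Finset.sum_boole, hcard, Nat.cast_add_one]

theorem zetaMatrix_mulVec_single_apply {a : ThreeBranchVertex p q r} (ha : a.val = p) (t : ℝ)
    (i : ThreeBranchVertex p q r) :
    (zetaMatrix ℝ (ThreeBranchVertex p q r) *ᵥ Pi.single a t) i = if i.val ≤ p then t else 0 := by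
  have hle : i ≤ a ↔ i.val ≤ p := by
    simp only [le_def, ha, branchEnd]
    split_ifs <;> omega
  simp [zetaMatrix, hle]

section RowSum

variable [DecidableRel (hasse (ThreeBranchVertex p q r)).Adj] {i a : ThreeBranchVertex p q r}

theorem zetaMatrix_mulVec_rowSum_bot (ha : a.val = p) (t : ℝ) :
    (zetaMatrix ℝ (ThreeBranchVertex p q r) *ᵥ
      (((hasse _).adjMatrix ℝ + diagonal (Pi.single a t)) *ᵥ 1)) ⊥ = 2 * (p + q + r) + t := by
  have hcard : (zetaMatrix ℝ (ThreeBranchVertex p q r) *ᵥ 1) ⊥ = p + q + r + 1 := by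
    simp [zetaMatrix_mulVec_bot, Fintype.card_congr equivFin]
  simp only [zetaMatrix_mulVec_adjMatrix_hasse_add_diagonal, Pi.add_apply, Pi.sub_apply,
    Pi.smul_apply, Pi.one_apply, Pi.single_eq_same, hcard, zetaMatrix_mulVec_single_apply ha,
    eq_bot_iff_val.mp, zero_le, if_true]
  ring

theorem zetaMatrix_mulVec_rowSum_apply (hi : i ≠ ⊥) (ha : a.val = p) (t : ℝ) :
    (zetaMatrix ℝ (ThreeBranchVertex p q r) *ᵥ
      (((hasse _).adjMatrix ℝ + diagonal (Pi.single a t)) *ᵥ 1)) i =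
      2 * ((branchEnd p q r i.val - i.val : ℕ) : ℝ) + 1 + if i.val ≤ p then t else 0 := by
  simp only [zetaMatrix_mulVec_adjMatrix_hasse_add_diagonal, Pi.add_apply, Pi.sub_apply,
    Pi.smul_apply, Pi.one_apply, Pi.single_eq_of_ne hi, zetaMatrix_mulVec_one_apply hi,
    zetaMatrix_mulVec_single_apply ha]
  ring

end RowSum

theorem sum_eq_sum_branches {M : Type*} [AddCommMonoid M] {f : ThreeBranchVertex p q r → M}
    {F G : ℕ → M} (hbot : f ⊥ = 0)
    (hf : ∀ i ≠ ⊥, f i = (if i.val ≤ p then F else G) (branchEnd p q r i.val - i.val)) :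
    ∑ i, f i = ∑ k ∈ Finset.range p, F k + ∑ k ∈ Finset.range q, G k +
      ∑ k ∈ Finset.range r, G k := by
  let g (k : ℕ) : M := (if k + 1 ≤ p then F else G) (branchEnd p q r (k + 1) - (k + 1))
  have hsum : ∑ i, f i = ∑ k ∈ Finset.range (p + q + r), g k := by
    rw [← equivFin.symm.sum_comp, Fin.sum_univ_succ, ← Fin.sum_univ_eq_sum_range]
    refine (congrArg₂ _ hbot (Finset.sum_congr rfl fun k _ ↦ ?_)).trans (zero_add _)
    exact hf _ (mt eq_bot_iff_val.mp k.val.succ_ne_zero)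
  have hbranch {m l : ℕ} {H : ℕ → M} (hH : ∀ k < l, g (m + k) = H (l - 1 - k)) :
      ∑ k ∈ Finset.range l, g (m + k) = ∑ k ∈ Finset.range l, H k := by
    rw [← Finset.sum_range_reflect H]
    exact Finset.sum_congr rfl fun k hk ↦ hH k (Finset.mem_range.mp hk)
  rw [hsum, Finset.sum_range_add, Finset.sum_range_add, hbranch (H := G), hbranch (H := G),
    ← hbranch (m := 0) (H := F)]
  · simp only [zero_add]
  all_goals
    intro k hk
    simp only [g, branchEnd]
    split_ifs <;> first | omega | (congr 1; omega)

theorem threeBranchTree_adj_iff {i j : ThreeBranchVertex p q r} :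
    (threeBranchTree p q r).Adj (equivFin i) (equivFin j) ↔
      (hasse (ThreeBranchVertex p q r)).Adj i j := by
  rw [threeBranchTree, fromRel_adj, hasse_adj, covBy_iff, covBy_iff, Ne, Fin.ext_iff]
  simp only [equivFin_apply_val]
  have := i.isLt
  have := j.isLt
  split_ifs <;> omega

theorem threeBranchAdj_add_single [DecidableRel (hasse (ThreeBranchVertex p q r)).Adj]
    (a : Fin (p + q + r + 1)) (t : ℝ) :
    threeBranchAdj p q r + Matrix.single a a t =
      ((hasse (ThreeBranchVertex p q r)).adjMatrix ℝ +
        diagonal (Pi.single (equivFin.symm a) t)).submatrix equivFin.symm equivFin.symm := by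
  classical
  rw [← diagonal_single]
  ext i j
  obtain ⟨i, rfl⟩ := equivFin.surjective i
  obtain ⟨j, rfl⟩ := equivFin.surjective j
  simp [threeBranchAdj, adjMatrix_apply, threeBranchTree_adj_iff, diagonal_apply, Pi.single_apply,
    Equiv.eq_symm_apply]

end ThreeBranchVertex

open ThreeBranchVertex in
theorem hasKemenyConstant_threeBranchAdj_add_single (hs : 0 < p + q + r)
    {a : Fin (p + q + r + 1)} (ha : (a : ℕ) = p) {t σ : ℝ} (ht : 0 ≤ t)
    (hσ : σ = 2 * (p + q + r) + t) :
    HasKemenyConstant (threeBranchAdj p q r + Matrix.single a a t)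
      ((∑ k ∈ Finset.range p, (2 * (k : ℝ) + (1 + t)) * (σ - (2 * k + (1 + t))) +
        ∑ k ∈ Finset.range q, (2 * (k : ℝ) + 1) * (σ - (2 * k + 1)) +
        ∑ k ∈ Finset.range r, (2 * (k : ℝ) + 1) * (σ - (2 * k + 1))) / σ) := by
  classical
  have : Nontrivial (ThreeBranchVertex p q r) := by
    have : Nontrivial (Fin (p + q + r + 1)) := Fin.nontrivial_iff_two_le.mpr (by omega)
    exact equivFin.nontrivial
  have hbot := zetaMatrix_mulVec_rowSum_bot (a := equivFin.symm a) ha t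
  rw [← hσ] at hbot
  rw [threeBranchAdj_add_single]
  convert (hasKemenyConstant_adjMatrix_hasse_add_diagonal (α := ThreeBranchVertex p q r)
    (Pi.single_nonneg.mpr ht) rfl).submatrix_equiv equivFin.symm using 2
  · rw [hbot, sum_eq_sum_branches (F := fun k ↦ (2 * (k : ℝ) + (1 + t)) * (σ - (2 * k + (1 + t))))
      (G := fun k ↦ (2 * (k : ℝ) + 1) * (σ - (2 * k + 1)))]
    · rw [hbot, sub_self, mul_zero]
    · intro i hi
      rw [zetaMatrix_mulVec_rowSum_apply hi ha]
      split_ifs <;> simp [add_assoc]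
  · exact hbot.symm

end ThreeBranch

theorem mainTheorem9 (p q r : ℕ) (hs : 0 < p + q + r) (s : ℝ) (hsum : s = (p : ℝ) + q + r) :
    HasKemenyConstant (threeBranchAdj p q r)
        ((2 * s ^ 2 + 1) / 6 - 2 * (p : ℝ) * q * r / s) ∧
      HasKemenyConstant (threeBranchLoopAdj p q r ⟨p, by omega⟩)
        (s * (s + 1) / 3 - 2 * (q : ℝ) * r * (2 * p + 1) / (2 * s + 1)) := by
  have hs_pos : (0 : ℝ) < p + q + r := by exact_mod_cast hs
  have hκ {t : ℝ} (ht : 0 ≤ t) := hasKemenyConstant_threeBranchAdj_add_single hs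
    (a := ⟨p, by omega⟩) rfl ht rfl
  simp only [sum_range_two_mul_add_mul_sub] at hκ
  subst hsum
  constructor
  · convert hκ le_rfl using 1
    · rw [Matrix.single_zero, add_zero]
    · field_simp
      ring
  · convert hκ zero_le_one using 1
    · rw [threeBranchLoopAdj]
    · field_simp
      ring
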